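/- For every integer $d\ge 1$ let $(X_{d,n})_{n\ge 0}$ be a simple random walk on $\mathbb{Z}^d$ started at the origin, that is, $X_{d,0}=0$ almost surely and the increments $X_{d,n+1}-X_{d,n}$, $n\ge 0$, are independent and uniformly distributed on the $2d$ vectors $\pm e_1,\dots,\pm e_d$, where $e_1,\dots,e_d$ is the standard basis. Let $$\tau_d=\inf\{n\ge 1 : X_{d,n}=0\}\in\mathbb{N}\cup\{\infty\}$$ be the first return time to the origin (with $\inf\emptyset=\infty$), and let $p_d=P(\tau_d<\infty)$ be the return probability. Then $$\lim_{d\to\infty} 2d\,p_d=1.$$ -/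

import Mathlib

open MeasureTheory ProbabilityTheory Filter Topology

/-- The `2d` nearest-neighbour steps `± e_i` of the lattice `ℤ^d`. -/
def latticeSteps (d : ℕ) : Set (Fin d → ℤ) :=
  {v | ∃ i : Fin d, v = Pi.single i 1 ∨ v = -Pi.single i 1}

/-- `X` is a simple random walk on `ℤ^d` started at the origin, under the probability measure `P`:
it starts at `0` almost surely, and its increments are independent and uniformly distributed on
the `2d` vectors `± e_i`. -/
structure IsSimpleRandomWalk {Ω : Type*} [MeasurableSpace Ω] (P : Measure Ω) (d : ℕ)
    (X : ℕ → Ω → (Fin d → ℤ)) : Prop where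
  measurable : ∀ n, Measurable (X n)
  start : ∀ᵐ ω ∂P, X 0 ω = 0
  indep : iIndepFun (fun n ω => X (n + 1) ω - X n ω) P
  step : ∀ n, P.map (fun ω => X (n + 1) ω - X n ω) = uniformOn (latticeSteps d)

/-- The first return time `inf {n ≥ 1 | X n = 0}` to the origin; it is `⊤` if there is no
such `n`. -/
noncomputable def returnTime {Ω : Type*} {d : ℕ} (X : ℕ → Ω → (Fin d → ℤ)) : Ω → WithTop ℕ :=
  hittingAfter X {0} 1

/-- The return probability `P (τ < ∞)`. -/
noncomputable def returnProb {Ω : Type*} [MeasurableSpace Ω] (P : Measure Ω) {d : ℕ}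
    (X : ℕ → Ω → (Fin d → ℤ)) : ℝ :=
  P.real {ω | returnTime X ω < ⊤}

/-! The lower bound is the event of returning at time 2, which has probability `1/(2d)`. For the
upper bound, the return probability is at most the sum over n ≥ 1 of P(X_n = 0), which equals the
integral of S^n over the unit cube with S = `cosMean θ` (`iterate_neighbourMean_originIndicator`).
Times 1 and 3 vanish by parity and time 2 gives `1/(2d)`, so the tail must be o(1/d). It is at most
twice the integral of S^4/(1-S).

Where |S| < ε, the integrand is at most 2ε²S², whose integral is ε²/d. Where |S| ≥ ε, a Chernoff
tilt is combined with an AM-GM bound for 1/(1-S) by a product over coordinates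
(`prod_rpow_le_one_sub_cosMean`). The integral then factorises into a d-th power whose base tends to
a limit below 1, so it decays exponentially. Altogether 2d·p_d ≤ 1 + 4ε² + o(1). -/

/-- The average of `f` over the `2d` neighbours of `x` in `ℤ^d`. -/
noncomputable def neighbourMean {d : ℕ} (f : (Fin d → ℤ) → ℝ) (x : Fin d → ℤ) : ℝ :=
  (2 * (d : ℝ))⁻¹ * ∑ i : Fin d, (f (x + Pi.single i 1) + f (x - Pi.single i 1))

/-- The `2d` nearest-neighbour steps as a finset. -/
def latticeStepsFinset (d : ℕ) : Finset (Fin d → ℤ) :=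
  Finset.univ.image (fun i => Pi.single i 1) ∪ Finset.univ.image (fun i => -Pi.single i 1)

lemma coe_latticeStepsFinset (d : ℕ) : (latticeStepsFinset d : Set (Fin d → ℤ)) = latticeSteps d := by
  ext v
  simp only [latticeStepsFinset, latticeSteps, Finset.coe_union, Finset.coe_image, Finset.coe_univ,
    Set.image_univ, Set.mem_union, Set.mem_range, Set.mem_ofPred_eq]
  constructor
  · rintro (⟨i, rfl⟩ | ⟨i, rfl⟩)
    · exact ⟨i, Or.inl rfl⟩
    · exact ⟨i, Or.inr rfl⟩
  · rintro ⟨i, rfl | rfl⟩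
    · exact Or.inl ⟨i, rfl⟩
    · exact Or.inr ⟨i, rfl⟩

lemma single_one_injective (d : ℕ) :
    Function.Injective (fun i : Fin d => (Pi.single i 1 : Fin d → ℤ)) := by
  intro i j h
  by_contra hij
  have := congrFun h i
  simp [Pi.single_eq_of_ne hij] at this

lemma single_one_ne_neg {d : ℕ} (i j : Fin d) :
    (Pi.single i 1 : Fin d → ℤ) ≠ -Pi.single j 1 := by
  intro h
  have h := congrFun h i
  by_cases hij : i = j
  · subst hij; simp at h
  · simp [Pi.single_eq_of_ne hij] at h

lemma sum_latticeStepsFinset (d : ℕ) (f : (Fin d → ℤ) → ℝ) :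
    ∑ v ∈ latticeStepsFinset d, f v = ∑ i : Fin d, (f (Pi.single i 1) + f (-Pi.single i 1)) := by
  rw [latticeStepsFinset, Finset.sum_union, Finset.sum_image, Finset.sum_image,
    Finset.sum_add_distrib]
  · intro i _ j _ h
    exact single_one_injective d (neg_injective h)
  · exact (single_one_injective d).injOn
  · rw [Finset.disjoint_left]
    simp only [Finset.mem_image, Finset.mem_univ, true_and]
    rintro _ ⟨i, rfl⟩ ⟨j, h⟩
    exact single_one_ne_neg i j h.symm

lemma card_latticeStepsFinset (d : ℕ) : (latticeStepsFinset d).card = 2 * d := by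
  have h := sum_latticeStepsFinset d (fun _ => 1)
  have h' : ((latticeStepsFinset d).card : ℝ) = ((2 * d : ℕ) : ℝ) := by
    simpa [mul_comm, two_mul, mul_add, one_add_one_eq_two] using h
  exact_mod_cast h'

lemma integral_uniformOn_latticeSteps {d : ℕ} (f : (Fin d → ℤ) → ℝ) (x : Fin d → ℤ) :
    ∫ v, f (x + v) ∂(uniformOn (latticeSteps d)) = neighbourMean f x := by
  have hI : IntegrableOn (fun v => f (x + v)) (latticeStepsFinset d) Measure.count := by
    rw [← Set.biUnion_of_singleton (latticeStepsFinset d : Set (Fin d → ℤ))]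
    exact integrableOn_finset_iUnion.2 fun v _ => integrableOn_singleton (hx := by simp)
  rw [← coe_latticeStepsFinset, uniformOn, ProbabilityTheory.cond, integral_smul_measure,
    setIntegral_finset _ hI, Measure.count_apply_finset, card_latticeStepsFinset]
  simp [Measure.real, neighbourMean, sum_latticeStepsFinset d (fun v => f (x + v)), sub_eq_add_neg]

/-! ### The law of the walk through iterates of the averaging operator -/

namespace IsSimpleRandomWalk

variable {Ω : Type*} [MeasurableSpace Ω] {P : Measure Ω} {d : ℕ} {X : ℕ → Ω → (Fin d → ℤ)}

lemma ae_eq_sum (hX : IsSimpleRandomWalk P d X) (n : ℕ) :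
    (∑ k ∈ Finset.range n, fun ω => X (k + 1) ω - X k ω) =ᵐ[P] X n := by
  filter_upwards [hX.start] with ω h
  rw [Finset.sum_apply, Finset.sum_range_sub (fun k => X k ω), h, sub_zero]

lemma indepFun_increment (hX : IsSimpleRandomWalk P d X) (n : ℕ) :
    IndepFun (X n) (fun ω => X (n + 1) ω - X n ω) P :=
  (hX.indep.indepFun_sum_range_succ
    (fun k => (hX.measurable (k + 1)).sub (hX.measurable k)) n).congr (hX.ae_eq_sum n) .rfl

lemma integral_succ [IsProbabilityMeasure P] (hX : IsSimpleRandomWalk P d X) (n : ℕ)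
    {f : (Fin d → ℤ) → ℝ} (hf : ∀ x, |f x| ≤ 1) :
    ∫ ω, f (X (n + 1) ω) ∂P = ∫ ω, neighbourMean f (X n ω) ∂P := by
  have hm : Measurable (fun ω => X (n + 1) ω - X n ω) :=
    (hX.measurable (n + 1)).sub (hX.measurable n)
  have h := (indepFun_iff_map_prod_eq_prod_map_map (hX.measurable n).aemeasurable
    hm.aemeasurable).1 (hX.indepFun_increment n)
  have : IsProbabilityMeasure (P.map (X n)) :=
    Measure.isProbabilityMeasure_map (hX.measurable n).aemeasurable
  have : IsProbabilityMeasure (P.map (fun ω => X (n + 1) ω - X n ω)) :=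
    Measure.isProbabilityMeasure_map hm.aemeasurable
  have hF : Measurable (fun p : (Fin d → ℤ) × (Fin d → ℤ) => f (p.1 + p.2)) :=
    (Measurable.of_discrete (f := f)).comp measurable_add
  calc ∫ ω, f (X (n + 1) ω) ∂P
      = ∫ p, f (p.1 + p.2) ∂(P.map (fun ω => (X n ω, X (n + 1) ω - X n ω))) := by
        rw [integral_map ((hX.measurable n).prodMk hm).aemeasurable hF.aestronglyMeasurable]
        simp
    _ = ∫ x, neighbourMean f x ∂(P.map (X n)) := by
        rw [h, integral_prod, hX.step n]
        · simp only [integral_uniformOn_latticeSteps]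
        · exact Integrable.of_bound hF.aestronglyMeasurable 1 (by simp [hf])
    _ = _ := integral_map (hX.measurable n).aemeasurable
        Measurable.of_discrete.aestronglyMeasurable

end IsSimpleRandomWalk

lemma abs_neighbourMean_le {d : ℕ} {f : (Fin d → ℤ) → ℝ} (hf : ∀ x, |f x| ≤ 1) (x : Fin d → ℤ) :
    |neighbourMean f x| ≤ 1 := by
  rw [neighbourMean, abs_mul, abs_of_nonneg (by positivity)]
  have h : |∑ i : Fin d, (f (x + Pi.single i 1) + f (x - Pi.single i 1))| ≤ 2 * (d : ℝ) := by
    refine (Finset.abs_sum_le_sum_abs _ _).trans ?_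
    refine (Finset.sum_le_sum (g := fun _ => (2 : ℝ)) fun i _ => ?_).trans (by simp [mul_comm])
    exact (abs_add_le _ _).trans (by linarith [hf (x + Pi.single i 1), hf (x - Pi.single i 1)])
  exact (mul_le_mul_of_nonneg_left h (by positivity)).trans (inv_mul_le_one)

lemma IsSimpleRandomWalk.integral_eq_iterate {Ω : Type*} [MeasurableSpace Ω] {P : Measure Ω}
    [IsProbabilityMeasure P] {d : ℕ} {X : ℕ → Ω → (Fin d → ℤ)} (hX : IsSimpleRandomWalk P d X)
    (n : ℕ) {f : (Fin d → ℤ) → ℝ} (hf : ∀ x, |f x| ≤ 1) :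
    ∫ ω, f (X n ω) ∂P = neighbourMean^[n] f 0 := by
  induction n generalizing f with
  | zero =>
    have : (fun ω => f (X 0 ω)) =ᵐ[P] fun _ => f 0 := by
      filter_upwards [hX.start] with ω h
      rw [h]
    rw [integral_congr_ae this]
    simp
  | succ n ih => rw [hX.integral_succ n hf, ih (abs_neighbourMean_le hf), Function.iterate_succ_apply]

/-- The indicator function of the origin. -/
noncomputable def originIndicator (d : ℕ) : (Fin d → ℤ) → ℝ := fun x => if x = 0 then 1 else 0

lemma abs_originIndicator_le {d : ℕ} (x : Fin d → ℤ) : |originIndicator d x| ≤ 1 := by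
  unfold originIndicator; split_ifs <;> simp

lemma IsSimpleRandomWalk.measureReal_eq_zero {Ω : Type*} [MeasurableSpace Ω] {P : Measure Ω}
    [IsProbabilityMeasure P] {d : ℕ} {X : ℕ → Ω → (Fin d → ℤ)} (hX : IsSimpleRandomWalk P d X)
    (n : ℕ) : P.real {ω | X n ω = 0} = neighbourMean^[n] (originIndicator d) 0 := by
  rw [← hX.integral_eq_iterate n abs_originIndicator_le]
  have hs : MeasurableSet {ω | X n ω = 0} := hX.measurable n (measurableSet_singleton 0)
  rw [← integral_indicator_one hs]
  congr with ω
  simp [Set.indicator_apply, originIndicator]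

/-- Every step changes the parity of the coordinate sum. -/
lemma iterate_neighbourMean_originIndicator_of_odd {d : ℕ} (n : ℕ) (x : Fin d → ℤ)
    (h : Odd ((n : ℤ) + ∑ i, x i)) : neighbourMean^[n] (originIndicator d) x = 0 := by
  induction n generalizing x with
  | zero =>
    have : x ≠ 0 := by rintro rfl; simp at h
    simp [originIndicator, this]
  | succ n ih =>
    rw [Function.iterate_succ_apply', neighbourMean, Finset.sum_eq_zero, mul_zero]
    intro i _
    rw [ih, ih, add_zero]
    · simp only [Pi.sub_apply, Finset.sum_sub_distrib, Finset.sum_pi_single', Finset.mem_univ, if_true]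
      push_cast at h
      rw [Int.odd_iff] at h ⊢
      omega
    · simp only [Pi.add_apply, Finset.sum_add_distrib, Finset.sum_pi_single', Finset.mem_univ, if_true]
      push_cast at h
      rw [Int.odd_iff] at h ⊢
      omega

lemma iterate_two_neighbourMean_originIndicator {d : ℕ} (hd : 1 ≤ d) :
    neighbourMean^[2] (originIndicator d) 0 = (2 * (d : ℝ))⁻¹ := by
  have hd' : (d : ℝ) ≠ 0 := by positivity
  have h1 : ∀ i : Fin d, neighbourMean (originIndicator d) (Pi.single i 1) = (2 * (d : ℝ))⁻¹ := by
    intro i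
    have : ∀ j : Fin d, originIndicator d (Pi.single i 1 + Pi.single j 1) +
        originIndicator d (Pi.single i 1 - Pi.single j 1) = if i = j then 1 else 0 := by
      intro j
      simp only [originIndicator, sub_eq_zero, add_eq_zero_iff_eq_neg, single_one_ne_neg,
        (single_one_injective d).eq_iff, if_false, zero_add]
    simp [neighbourMean, this]
  have h2 : ∀ i : Fin d, neighbourMean (originIndicator d) (-Pi.single i 1) = (2 * (d : ℝ))⁻¹ := by
    intro i
    have : ∀ j : Fin d, originIndicator d (-Pi.single i 1 + Pi.single j 1) +
        originIndicator d (-Pi.single i 1 - Pi.single j 1) = if i = j then 1 else 0 := by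
      intro j
      simp only [originIndicator, sub_eq_zero, neg_add_eq_zero, (single_one_ne_neg _ _).symm,
        (single_one_injective d).eq_iff, if_false, add_zero]
    simp [neighbourMean, this]
  rw [Function.iterate_succ_apply, Function.iterate_one, neighbourMean]
  simp only [zero_add, zero_sub, h1, h2, Finset.sum_const, Finset.card_univ, Fintype.card_fin, nsmul_eq_mul]
  field_simp
  norm_num

/-! ### Fourier representation by real cosines -/

/-- The uniform measure on the unit interval. -/
noncomputable abbrev unitIntervalMeasure : Measure ℝ := volume.restrict (Set.Ioc 0 1)

instance : IsProbabilityMeasure unitIntervalMeasure := ⟨by simp⟩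

/-- The uniform measure on the unit cube. -/
noncomputable abbrev unitCubeMeasure (d : ℕ) : Measure (Fin d → ℝ) :=
  Measure.pi fun _ => unitIntervalMeasure

/-- The characteristic function `(1/d) ∑ cos (π θ_i)` of a step of the walk. -/
noncomputable def cosMean {d : ℕ} (θ : Fin d → ℝ) : ℝ := (d : ℝ)⁻¹ * ∑ i, Real.cos (Real.pi * θ i)

/-- The eigenfunction `∏ cos (π θ_j x_j)` of `neighbourMean`. -/
noncomputable def cosProd {d : ℕ} (θ : Fin d → ℝ) (x : Fin d → ℤ) : ℝ :=
  ∏ i, Real.cos (Real.pi * θ i * x i)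

lemma cosProd_add_cosProd_sub {d : ℕ} (θ : Fin d → ℝ) (x : Fin d → ℤ) (i : Fin d) :
    cosProd θ (x + Pi.single i 1) + cosProd θ (x - Pi.single i 1) =
      2 * Real.cos (Real.pi * θ i) * cosProd θ x := by
  have key : ∀ y : Fin d → ℤ, (∀ j ≠ i, y j = x j) → cosProd θ y =
      Real.cos (Real.pi * θ i * y i) *
        ∏ j ∈ Finset.univ.erase i, Real.cos (Real.pi * θ j * x j) := by
    intro y hy
    rw [cosProd, ← Finset.mul_prod_erase _ _ (Finset.mem_univ i)]
    congr 1
    exact Finset.prod_congr rfl fun j hj => by rw [hy j (Finset.ne_of_mem_erase hj)]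
  rw [key _ fun j hj => by simp [hj], key _ fun j hj => by simp [hj], key x fun _ _ => rfl]
  simp only [Pi.add_apply, Pi.sub_apply, Pi.single_eq_same, Int.cast_add, Int.cast_sub,
    Int.cast_one, mul_add, mul_sub, mul_one, Real.cos_add, Real.cos_sub]
  ring

lemma neighbourMean_cosProd {d : ℕ} (θ : Fin d → ℝ) (x : Fin d → ℤ) :
    neighbourMean (cosProd θ) x = cosMean θ * cosProd θ x := by
  simp only [neighbourMean, cosProd_add_cosProd_sub, cosMean, ← Finset.sum_mul, ← Finset.mul_sum,
    mul_inv]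
  ring

lemma integral_cos_int (m : ℤ) :
    ∫ t, Real.cos (Real.pi * t * m) ∂unitIntervalMeasure = if m = 0 then 1 else 0 := by
  rw [← intervalIntegral.integral_of_le zero_le_one]
  split_ifs with h
  · simp [h]
  · have hm : Real.pi * (m : ℝ) ≠ 0 := mul_ne_zero Real.pi_ne_zero (by exact_mod_cast h)
    have : ∀ t : ℝ, Real.pi * t * m = Real.pi * m * t := fun t => by ring
    simp only [this]
    rw [intervalIntegral.integral_comp_mul_left _ hm]
    simp [mul_comm Real.pi, Real.sin_int_mul_pi]

lemma integral_cosProd {d : ℕ} (x : Fin d → ℤ) :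
    ∫ θ, cosProd θ x ∂unitCubeMeasure d = originIndicator d x := by
  simp only [cosProd]
  rw [integral_fintype_prod_eq_prod (f := fun i t => Real.cos (Real.pi * t * x i))]
  simp only [integral_cos_int, originIndicator, Finset.prod_ite_zero, Finset.prod_const_one,
    funext_iff, Finset.mem_univ, true_implies, Pi.zero_apply]

lemma continuous_cosMean (d : ℕ) : Continuous (cosMean (d := d)) := by
  unfold cosMean; fun_prop

lemma continuous_cosProd {d : ℕ} (x : Fin d → ℤ) : Continuous (fun θ => cosProd θ x) := by
  unfold cosProd; fun_prop

lemma abs_cosMean_le {d : ℕ} (θ : Fin d → ℝ) : |cosMean θ| ≤ 1 := by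
  rw [cosMean, abs_mul, abs_of_nonneg (by positivity)]
  have h : |∑ i, Real.cos (Real.pi * θ i)| ≤ d :=
    (Finset.abs_sum_le_sum_abs _ _).trans
      ((Finset.sum_le_sum fun i _ => Real.abs_cos_le_one _).trans (by simp))
  exact (mul_le_mul_of_nonneg_left h (by positivity)).trans inv_mul_le_one

lemma abs_cosProd_le {d : ℕ} (θ : Fin d → ℝ) (x : Fin d → ℤ) : |cosProd θ x| ≤ 1 := by
  rw [cosProd, Finset.abs_prod]
  exact Finset.prod_le_one (fun _ _ => abs_nonneg _) fun _ _ => Real.abs_cos_le_one _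

lemma integrable_cosMean_pow_mul_cosProd {d : ℕ} (n : ℕ) (x : Fin d → ℤ) :
    Integrable (fun θ => cosMean θ ^ n * cosProd θ x) (unitCubeMeasure d) := by
  refine Integrable.of_bound (((continuous_cosMean d).pow n).mul
    (continuous_cosProd x)).aestronglyMeasurable 1 (ae_of_all _ fun θ => ?_)
  rw [norm_mul, norm_pow]
  exact mul_le_one₀ (pow_le_one₀ (norm_nonneg _) (abs_cosMean_le θ)) (norm_nonneg _)
    (abs_cosProd_le θ x)

/-- Orthogonality of cosines writes the indicator as an integral of eigenfunctions; each averaging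
then contributes one eigenvalue factor. -/
lemma iterate_neighbourMean_originIndicator {d : ℕ} (n : ℕ) (x : Fin d → ℤ) :
    neighbourMean^[n] (originIndicator d) x =
      ∫ θ, cosMean θ ^ n * cosProd θ x ∂unitCubeMeasure d := by
  induction n generalizing x with
  | zero => simp [integral_cosProd]
  | succ n ih =>
    have hI := integrable_cosMean_pow_mul_cosProd (d := d) n
    rw [Function.iterate_succ_apply', neighbourMean]
    simp only [ih]
    simp_rw [← integral_add (hI _) (hI _)]
    rw [← integral_finsetSum _ fun i _ => by exact (hI _).add (hI _), ← integral_const_mul]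
    congr with θ
    rw [pow_succ, mul_assoc, ← neighbourMean_cosProd, neighbourMean]
    simp only [← mul_add, ← Finset.mul_sum]
    ring

lemma integrable_cosMean_pow (d n : ℕ) :
    Integrable (fun θ => cosMean θ ^ n) (unitCubeMeasure d) := by
  simpa [cosProd] using integrable_cosMean_pow_mul_cosProd (d := d) n 0

lemma iterate_neighbourMean_originIndicator_zero (d n : ℕ) :
    neighbourMean^[n] (originIndicator d) 0 = ∫ θ, cosMean θ ^ n ∂unitCubeMeasure d := by
  simp [iterate_neighbourMean_originIndicator, cosProd]

lemma integral_cosMean_sq {d : ℕ} (hd : 1 ≤ d) :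
    ∫ θ, cosMean θ ^ 2 ∂unitCubeMeasure d = (2 * (d : ℝ))⁻¹ := by
  rw [← iterate_neighbourMean_originIndicator_zero, iterate_two_neighbourMean_originIndicator hd]

lemma integral_cosMean_pow_of_odd {d n : ℕ} (hn : Odd n) :
    ∫ θ, cosMean θ ^ n ∂unitCubeMeasure d = 0 := by
  rw [← iterate_neighbourMean_originIndicator_zero]
  exact iterate_neighbourMean_originIndicator_of_odd n 0 (by simpa using hn)

/-! ### Pointwise bounds near and away from S = 0 -/

/-- AM-GM applied to 1 - cos(πt) ≥ t² on (0, 1]. A product is wanted because it integrates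
coordinate by coordinate, with a singularity of exponent only 2/d in each. -/
lemma prod_rpow_le_one_sub_cosMean {d : ℕ} (hd : 1 ≤ d) {θ : Fin d → ℝ}
    (hθ : ∀ i, θ i ∈ Set.Ioc (0 : ℝ) 1) : ∏ i, θ i ^ (2 / (d : ℝ)) ≤ 1 - cosMean θ := by
  have hd' : (0 : ℝ) < d := by exact_mod_cast hd
  have hcos : ∀ i, θ i ^ 2 ≤ 1 - Real.cos (Real.pi * θ i) := by
    intro i
    have h := Real.cos_le_one_sub_mul_cos_sq (x := Real.pi * θ i) (by
      rw [abs_of_nonneg (mul_nonneg Real.pi_pos.le (hθ i).1.le)]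
      exact mul_le_of_le_one_right Real.pi_pos.le (hθ i).2)
    have : 2 / Real.pi ^ 2 * (Real.pi * θ i) ^ 2 = 2 * θ i ^ 2 := by
      field_simp
    nlinarith [sq_nonneg (θ i)]
  have hamgm := Real.geom_mean_le_arith_mean_weighted Finset.univ (fun _ : Fin d => (d : ℝ)⁻¹)
    (fun i => θ i ^ 2) (fun _ _ => by positivity) (by simp [hd'.ne']) (fun _ _ => by positivity)
  have hprod : ∏ i, θ i ^ (2 / (d : ℝ)) = ∏ i, (θ i ^ 2) ^ (d : ℝ)⁻¹ :=
    Finset.prod_congr rfl fun i _ => by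
      rw [← Real.rpow_natCast, ← Real.rpow_mul (hθ i).1.le, div_eq_mul_inv, Nat.cast_ofNat]
  rw [hprod]
  refine hamgm.trans ?_
  have hsum : 1 - cosMean θ = ∑ i, (d : ℝ)⁻¹ * (1 - Real.cos (Real.pi * θ i)) := by
    rw [← Finset.mul_sum, Finset.sum_sub_distrib, cosMean]
    simp [mul_sub, hd'.ne']
  rw [hsum]
  exact Finset.sum_le_sum fun i _ => mul_le_mul_of_nonneg_left (hcos i) (by positivity)

/-- The exponential tilt of `cos (π t)`, centred at `ε` and with a singular weight at `0`. -/
noncomputable def tiltedWeight (s ε r t : ℝ) : ℝ :=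
  Real.exp (ε / 2 * (s * Real.cos (Real.pi * t) - ε)) * t ^ (-r)

lemma tiltedWeight_nonneg (s ε r : ℝ) {t : ℝ} (ht : 0 ≤ t) : 0 ≤ tiltedWeight s ε r t :=
  mul_nonneg (Real.exp_nonneg _) (Real.rpow_nonneg ht _)

/-- The tilts multiply to exp((ε/2)·d·(sS - ε)), which is at least 1 on this region. The signs s =
±1 treat S ≥ ε and S ≤ -ε. -/
lemma inv_one_sub_cosMean_le_prod_tiltedWeight {d : ℕ} (hd : 1 ≤ d) {θ : Fin d → ℝ}
    (hθ : ∀ i, θ i ∈ Set.Ioc (0 : ℝ) 1) {s ε : ℝ} (hε : 0 ≤ ε) (h : ε ≤ s * cosMean θ) :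
    (1 - cosMean θ)⁻¹ ≤ ∏ i, tiltedWeight s ε (2 / d) (θ i) := by
  have hd' : (0 : ℝ) < d := by exact_mod_cast hd
  have hpos : 0 < ∏ i, θ i ^ (2 / (d : ℝ)) :=
    Finset.prod_pos fun i _ => Real.rpow_pos_of_pos (hθ i).1 _
  simp only [tiltedWeight, Finset.prod_mul_distrib, ← Real.exp_sum]
  have h1 : ∏ i, θ i ^ (-(2 / (d : ℝ))) = (∏ i, θ i ^ (2 / (d : ℝ)))⁻¹ := by
    rw [← Finset.prod_inv_distrib]
    exact Finset.prod_congr rfl fun i _ => Real.rpow_neg (hθ i).1.le _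
  have h2 : ∑ i, ε / 2 * (s * Real.cos (Real.pi * θ i) - ε) =
      ε / 2 * (d * (s * cosMean θ - ε)) := by
    rw [← Finset.mul_sum, Finset.sum_sub_distrib, ← Finset.mul_sum, cosMean]
    simp only [Finset.sum_const, Finset.card_univ, Fintype.card_fin, nsmul_eq_mul]
    field_simp
  rw [h1, h2]
  refine (inv_anti₀ hpos (prod_rpow_le_one_sub_cosMean hd hθ)).trans
    (le_mul_of_one_le_left (by positivity) (Real.one_le_exp ?_))
  have : 0 ≤ s * cosMean θ - ε := by linarith
  positivity

/-- A majorant of `S ^ 4 / (1 - S)`, where `S = cosMean θ`. -/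
noncomputable def tailMajorant (d : ℕ) (ε : ℝ) (θ : Fin d → ℝ) : ℝ :=
  2 * ε ^ 2 * cosMean θ ^ 2 + ∏ i, tiltedWeight 1 ε (2 / d) (θ i) +
    ∏ i, tiltedWeight (-1) ε (2 / d) (θ i)

lemma cosMean_lt_one {d : ℕ} (hd : 1 ≤ d) {θ : Fin d → ℝ}
    (hθ : ∀ i, θ i ∈ Set.Ioc (0 : ℝ) 1) : cosMean θ < 1 := by
  have hpos : 0 < ∏ i, θ i ^ (2 / (d : ℝ)) :=
    Finset.prod_pos fun i _ => Real.rpow_pos_of_pos (hθ i).1 _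
  linarith [prod_rpow_le_one_sub_cosMean hd hθ]

lemma cosMean_pow_four_div_le {d : ℕ} (hd : 1 ≤ d) {θ : Fin d → ℝ}
    (hθ : ∀ i, θ i ∈ Set.Ioc (0 : ℝ) 1) {ε : ℝ} (hε : 0 < ε) (hε' : ε ≤ 1 / 2) :
    cosMean θ ^ 4 * (1 - cosMean θ)⁻¹ ≤ tailMajorant d ε θ := by
  have hlt := cosMean_lt_one hd hθ
  have h1 : 0 ≤ ∏ i, tiltedWeight 1 ε (2 / d) (θ i) :=
    Finset.prod_nonneg fun i _ => tiltedWeight_nonneg _ _ _ (hθ i).1.le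
  have h2 : 0 ≤ ∏ i, tiltedWeight (-1) ε (2 / d) (θ i) :=
    Finset.prod_nonneg fun i _ => tiltedWeight_nonneg _ _ _ (hθ i).1.le
  have h3 : 0 ≤ 2 * ε ^ 2 * cosMean θ ^ 2 := by positivity
  have hinv : 0 ≤ (1 - cosMean θ)⁻¹ := inv_nonneg.2 (by linarith)
  have hle : cosMean θ ^ 4 * (1 - cosMean θ)⁻¹ ≤ (1 - cosMean θ)⁻¹ := by
    refine mul_le_of_le_one_left hinv ?_
    rw [← Even.pow_abs (by decide)]
    exact pow_le_one₀ (abs_nonneg _) (abs_cosMean_le θ)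
  unfold tailMajorant
  rcases le_or_gt ε (cosMean θ) with h | h
  · have := inv_one_sub_cosMean_le_prod_tiltedWeight hd hθ (s := 1) hε.le (by simpa using h)
    linarith
  rcases le_or_gt ε (-cosMean θ) with h' | h'
  · have := inv_one_sub_cosMean_le_prod_tiltedWeight hd hθ (s := -1) hε.le (by simpa using h')
    linarith
  have hsq : cosMean θ ^ 2 ≤ ε ^ 2 := sq_le_sq' (by linarith) h.le
  -- Here |S| < ε ≤ 1/2, so the singularity at S = 1 is far away.
  have hinv2 : (1 - cosMean θ)⁻¹ ≤ 2 := by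
    rw [inv_le_comm₀ (by linarith) two_pos]
    linarith
  have : cosMean θ ^ 4 * (1 - cosMean θ)⁻¹ ≤ ε ^ 2 * cosMean θ ^ 2 * 2 := by
    refine mul_le_mul ?_ hinv2 hinv (by positivity)
    nlinarith [sq_nonneg (cosMean θ)]
  linarith

/-! ### One-dimensional integrals and their exponential decay -/

lemma measurable_tiltedWeight (s ε r : ℝ) : Measurable (tiltedWeight s ε r) := by
  unfold tiltedWeight; fun_prop

lemma tiltedWeight_le {s ε r t : ℝ} (hs : |s| ≤ 1) (hε : 0 ≤ ε) (hr : r ≤ 2 / 3)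
    (ht : t ∈ Set.Ioc (0 : ℝ) 1) :
    tiltedWeight s ε r t ≤ Real.exp (ε / 2) * t ^ (-(2 / 3) : ℝ) := by
  unfold tiltedWeight
  have h1 : s * Real.cos (Real.pi * t) ≤ 1 := by
    refine (le_abs_self _).trans ?_
    rw [abs_mul]
    exact mul_le_one₀ hs (abs_nonneg _) (Real.abs_cos_le_one _)
  refine mul_le_mul (Real.exp_le_exp.2 ?_) ?_ (Real.rpow_nonneg ht.1.le _) (Real.exp_nonneg _)
  · exact mul_le_of_le_one_right (by linarith) (by linarith)
  · exact Real.rpow_le_rpow_of_exponent_ge ht.1 ht.2 (by linarith)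

lemma integrable_rpow_unitInterval :
    Integrable (fun t : ℝ => t ^ (-(2 / 3) : ℝ)) unitIntervalMeasure := by
  have := intervalIntegral.intervalIntegrable_rpow' (a := 0) (b := 1) (r := -(2 / 3)) (by norm_num)
  rwa [intervalIntegrable_iff_integrableOn_Ioc_of_le zero_le_one] at this

lemma ae_unitInterval_mem : ∀ᵐ t ∂unitIntervalMeasure, t ∈ Set.Ioc (0 : ℝ) 1 :=
  ae_restrict_mem measurableSet_Ioc

lemma integrable_tiltedWeight {s ε r : ℝ} (hs : |s| ≤ 1) (hε : 0 ≤ ε) (hr : r ≤ 2 / 3) :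
    Integrable (tiltedWeight s ε r) unitIntervalMeasure := by
  refine (integrable_rpow_unitInterval.const_mul (Real.exp (ε / 2))).mono'
    (measurable_tiltedWeight s ε r).aestronglyMeasurable ?_
  filter_upwards [ae_unitInterval_mem] with t ht
  rw [Real.norm_of_nonneg (tiltedWeight_nonneg _ _ _ ht.1.le)]
  exact tiltedWeight_le hs hε hr ht

/-- For d ≥ 3 the single integrable function t^(-2/3) dominates all the singular weights. -/
lemma eventually_two_div_le : ∀ᶠ d : ℕ in atTop, 2 / (d : ℝ) ≤ 2 / 3 := by
  filter_upwards [eventually_ge_atTop 3] with d hd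
  have : (3 : ℝ) ≤ d := by exact_mod_cast hd
  gcongr

lemma tendsto_integral_tiltedWeight {s ε : ℝ} (hs : |s| ≤ 1) (hε : 0 ≤ ε) :
    Tendsto (fun d : ℕ => ∫ t, tiltedWeight s ε (2 / d) t ∂unitIntervalMeasure) atTop
      (𝓝 (∫ t, Real.exp (ε / 2 * (s * Real.cos (Real.pi * t) - ε)) ∂unitIntervalMeasure)) := by
  refine tendsto_integral_filter_of_dominated_convergence
    (fun t => Real.exp (ε / 2) * t ^ (-(2 / 3) : ℝ))
    (Eventually.of_forall fun d => (measurable_tiltedWeight s ε _).aestronglyMeasurable) ?_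
    (integrable_rpow_unitInterval.const_mul _) ?_
  · filter_upwards [eventually_two_div_le] with d hd
    filter_upwards [ae_unitInterval_mem] with t ht
    rw [Real.norm_of_nonneg (tiltedWeight_nonneg _ _ _ ht.1.le)]
    exact tiltedWeight_le hs hε hd ht
  · filter_upwards [ae_unitInterval_mem] with t ht
    have h0 : Tendsto (fun d : ℕ => -(2 / (d : ℝ))) atTop (𝓝 0) := by
      simpa using (tendsto_const_div_atTop_nhds_zero_nat (2 : ℝ)).neg
    have := (Real.continuousAt_const_rpow (b := 0) ht.1.ne').tendsto.comp h0
    rw [Real.rpow_zero] at this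
    simpa [tiltedWeight] using this.const_mul
      (Real.exp (ε / 2 * (s * Real.cos (Real.pi * t) - ε)))

/-- Since the cosine has mean zero, e^x ≤ 1 + x + x² costs only ε²/4, while the centring gains the
factor exp(-ε²/2). -/
lemma integral_exp_tilt_lt_one {s ε : ℝ} (hs : |s| ≤ 1) (hε : 0 < ε) (hε' : ε ≤ 1 / 2) :
    ∫ t, Real.exp (ε / 2 * (s * Real.cos (Real.pi * t) - ε)) ∂unitIntervalMeasure < 1 := by
  have hcos : Integrable (fun t : ℝ => Real.cos (Real.pi * t)) unitIntervalMeasure :=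
    Integrable.of_bound (by fun_prop) 1 (ae_of_all _ fun t => Real.abs_cos_le_one _)
  have hint0 : ∫ t, Real.cos (Real.pi * t) ∂unitIntervalMeasure = 0 := by
    simpa using integral_cos_int 1
  have hbound : ∀ t : ℝ, Real.exp (ε / 2 * (s * Real.cos (Real.pi * t) - ε)) ≤
      Real.exp (-(ε ^ 2 / 2)) * (1 + ε ^ 2 / 4 + ε / 2 * s * Real.cos (Real.pi * t)) := by
    intro t
    have habs : |s * Real.cos (Real.pi * t)| ≤ 1 := by
      rw [abs_mul]
      exact mul_le_one₀ hs (abs_nonneg _) (Real.abs_cos_le_one _)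
    have hx : |ε / 2 * (s * Real.cos (Real.pi * t))| ≤ ε / 2 := by
      rw [abs_mul, abs_of_pos (half_pos hε)]
      exact mul_le_of_le_one_right (by linarith) habs
    have h := (abs_le.1 (Real.abs_exp_sub_one_sub_id_le (hx.trans (by linarith)))).2
    have hsq : (ε / 2 * (s * Real.cos (Real.pi * t))) ^ 2 ≤ (ε / 2) ^ 2 :=
      sq_le_sq' (abs_le.1 hx).1 (abs_le.1 hx).2
    rw [show ε / 2 * (s * Real.cos (Real.pi * t) - ε) =
      -(ε ^ 2 / 2) + ε / 2 * (s * Real.cos (Real.pi * t)) by ring, Real.exp_add]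
    refine mul_le_mul_of_nonneg_left ?_ (Real.exp_nonneg _)
    nlinarith
  have hle : ∫ t, Real.exp (ε / 2 * (s * Real.cos (Real.pi * t) - ε)) ∂unitIntervalMeasure ≤
      Real.exp (-(ε ^ 2 / 2)) * (1 + ε ^ 2 / 4) := by
    have hI : Integrable (fun t : ℝ => Real.exp (-(ε ^ 2 / 2)) *
        (1 + ε ^ 2 / 4 + ε / 2 * s * Real.cos (Real.pi * t))) unitIntervalMeasure :=
      ((integrable_const _).add (hcos.const_mul _)).const_mul _
    refine (integral_mono_of_nonneg (ae_of_all _ fun t => Real.exp_nonneg _) hI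
      (ae_of_all _ hbound)).trans_eq ?_
    rw [integral_const_mul, integral_add (integrable_const _) (hcos.const_mul _),
      integral_const_mul, hint0]
    simp
  calc _ ≤ Real.exp (-(ε ^ 2 / 2)) * (1 + ε ^ 2 / 4) := hle
    _ < Real.exp (-(ε ^ 2 / 2)) * Real.exp (ε ^ 2 / 2) := by
        refine mul_lt_mul_of_pos_left ?_ (Real.exp_pos _)
        nlinarith [Real.add_one_le_exp (ε ^ 2 / 2), sq_pos_of_pos hε]
    _ = 1 := by rw [← Real.exp_add]; simp

lemma tendsto_mul_integral_tiltedWeight_pow {s ε : ℝ} (hs : |s| ≤ 1) (hε : 0 < ε)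
    (hε' : ε ≤ 1 / 2) :
    Tendsto (fun d : ℕ => (d : ℝ) * (∫ t, tiltedWeight s ε (2 / d) t ∂unitIntervalMeasure) ^ d)
      atTop (𝓝 0) := by
  obtain ⟨q, hq, hq1⟩ := exists_between (integral_exp_tilt_lt_one hs hε hε')
  have hq0 : 0 ≤ q := (integral_nonneg fun t => Real.exp_nonneg _).trans hq.le
  have hnn : ∀ d : ℕ, 0 ≤ ∫ t, tiltedWeight s ε (2 / d) t ∂unitIntervalMeasure := fun d =>
    integral_nonneg_of_ae <| ae_unitInterval_mem.mono fun t ht => tiltedWeight_nonneg _ _ _ ht.1.le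
  refine squeeze_zero' (Eventually.of_forall fun d => by have := hnn d; positivity) ?_
    (tendsto_self_mul_const_pow_of_lt_one hq0 hq1)
  filter_upwards [(tendsto_integral_tiltedWeight hs hε.le).eventually_lt_const hq] with d hd
  have := hnn d
  gcongr

/-! ### The tail of the sum of return probabilities -/

lemma integrable_prod_tiltedWeight {d : ℕ} {s ε : ℝ} (hs : |s| ≤ 1) (hε : 0 ≤ ε)
    (hd : 2 / (d : ℝ) ≤ 2 / 3) :
    Integrable (fun θ : Fin d → ℝ => ∏ i, tiltedWeight s ε (2 / d) (θ i)) (unitCubeMeasure d) :=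
  Integrable.fintype_prod fun _ => integrable_tiltedWeight hs hε hd

lemma integrable_tailMajorant {d : ℕ} {ε : ℝ} (hε : 0 ≤ ε) (hd : 2 / (d : ℝ) ≤ 2 / 3) :
    Integrable (tailMajorant d ε) (unitCubeMeasure d) :=
  (((integrable_cosMean_pow d 2).const_mul _).add
    (integrable_prod_tiltedWeight (by simp) hε hd)).add
      (integrable_prod_tiltedWeight (by simp) hε hd)

lemma integral_tailMajorant {d : ℕ} (hd1 : 1 ≤ d) {ε : ℝ} (hε : 0 ≤ ε)
    (hd : 2 / (d : ℝ) ≤ 2 / 3) :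
    ∫ θ, tailMajorant d ε θ ∂unitCubeMeasure d = 2 * ε ^ 2 * (2 * (d : ℝ))⁻¹ +
      (∫ t, tiltedWeight 1 ε (2 / d) t ∂unitIntervalMeasure) ^ d +
      (∫ t, tiltedWeight (-1) ε (2 / d) t ∂unitIntervalMeasure) ^ d := by
  have h0 := (integrable_cosMean_pow d 2).const_mul (2 * ε ^ 2)
  have h1 := integrable_prod_tiltedWeight (d := d) (s := 1) (by simp) hε hd
  have h2 := integrable_prod_tiltedWeight (d := d) (s := -1) (by simp) hε hd
  unfold tailMajorant
  rw [integral_add (by exact h0.add h1) h2, integral_add h0 h1, integral_const_mul,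
    integral_cosMean_sq hd1,
    integral_fintype_prod_eq_prod (f := fun (_ : Fin d) => tiltedWeight 1 ε (2 / d)),
    integral_fintype_prod_eq_prod (f := fun (_ : Fin d) => tiltedWeight (-1) ε (2 / d))]
  simp

lemma ae_unitCube_mem (d : ℕ) :
    ∀ᵐ θ ∂unitCubeMeasure d, ∀ i, θ i ∈ Set.Ioc (0 : ℝ) 1 :=
  ae_all_iff.2 fun i =>
    (measurePreserving_eval (fun _ : Fin d => unitIntervalMeasure) i).quasiMeasurePreserving.ae
      ae_unitInterval_mem

lemma sum_integral_cosMean_pow_le {d : ℕ} (hd1 : 1 ≤ d) {ε : ℝ} (hε : 0 < ε) (hε' : ε ≤ 1 / 2)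
    (hd : 2 / (d : ℝ) ≤ 2 / 3) (N : ℕ) :
    ∑ n ∈ Finset.range (N + 3), ∫ θ, cosMean θ ^ (n + 1) ∂unitCubeMeasure d ≤
      (2 * (d : ℝ))⁻¹ + 2 * ∫ θ, tailMajorant d ε θ ∂unitCubeMeasure d := by
  have htail : ∑ n ∈ Finset.range N, ∫ θ, cosMean θ ^ (n + 4) ∂unitCubeMeasure d ≤
      2 * ∫ θ, tailMajorant d ε θ ∂unitCubeMeasure d := by
    rw [← integral_finsetSum _ fun n _ => integrable_cosMean_pow d (n + 4), ← integral_const_mul]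
    refine integral_mono_ae (integrable_finsetSum _ fun n _ => integrable_cosMean_pow d (n + 4))
      ((integrable_tailMajorant hε.le hd).const_mul 2) ?_
    filter_upwards [ae_unitCube_mem d] with θ hθ
    have hlt := cosMean_lt_one hd1 hθ
    have hpos : 0 < 1 - cosMean θ := by linarith
    -- S may be negative, so the finite geometric sum carries a factor 1 - S^N ≤ 2; this is the 2 in
    -- the bound.
    have hN : -1 ≤ cosMean θ ^ N := by
      have := pow_le_one₀ (n := N) (abs_nonneg _) (abs_cosMean_le θ)
      rw [← abs_pow] at this
      exact (abs_le.1 this).1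
    have hgeom : ∑ n ∈ Finset.range N, cosMean θ ^ (n + 4) =
        cosMean θ ^ 4 * (1 - cosMean θ)⁻¹ * (1 - cosMean θ ^ N) := by
      simp only [pow_add, ← Finset.sum_mul]
      rw [← geom_sum_mul_neg]
      field_simp
    rw [hgeom]
    have h4 : 0 ≤ cosMean θ ^ 4 * (1 - cosMean θ)⁻¹ := by positivity
    nlinarith [cosMean_pow_four_div_le hd1 hθ hε hε']
  -- Exponents 1, 2 and 3 are split off; the shifted sum starts at 4.
  rw [Finset.sum_range_succ', Finset.sum_range_succ', Finset.sum_range_succ',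
    integral_cosMean_pow_of_odd (n := 0 + 1) (by decide),
    integral_cosMean_pow_of_odd (n := 0 + 1 + 1 + 1) (by decide), integral_cosMean_sq hd1]
  linarith [htail]

/-! ### Comparison with the return probability and the limit -/

lemma measureReal_le_returnProb {Ω : Type*} [MeasurableSpace Ω] {P : Measure Ω}
    [IsProbabilityMeasure P] {d : ℕ} {X : ℕ → Ω → (Fin d → ℤ)}
    (n : ℕ) : P.real {ω | X (n + 1) ω = 0} ≤ returnProb P X := by
  refine measureReal_mono fun ω hω => ?_
  have h := hittingAfter_le_of_mem (u := X) (s := {0}) (ω := ω) (Nat.le_add_left 1 n) hω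
  exact h.trans_lt (WithTop.coe_lt_top _)

/-- Union bound over the return time. Arbitrarily long partial sums suffice because the terms are
nonnegative. -/
lemma returnProb_le_of_sum_le {Ω : Type*} [MeasurableSpace Ω] {P : Measure Ω}
    [IsProbabilityMeasure P] {d : ℕ} {X : ℕ → Ω → (Fin d → ℤ)}
    {B : ℝ} (hB : ∀ N, ∃ M ≥ N, ∑ n ∈ Finset.range M, P.real {ω | X (n + 1) ω = 0} ≤ B) :
    returnProb P X ≤ B := by
  have hB0 : 0 ≤ B := by
    obtain ⟨M, -, hM⟩ := hB 0
    exact (Finset.sum_nonneg fun _ _ => measureReal_nonneg).trans hM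
  have hsub : {ω | returnTime X ω < ⊤} ⊆ ⋃ n, {ω | X (n + 1) ω = 0} := by
    intro ω hω
    have h : hittingAfter X {0} 1 ω ≠ ⊤ := ne_of_lt hω
    rw [Ne, hittingAfter_eq_top_iff] at h
    push Not at h
    obtain ⟨j, hj, hj0⟩ := h
    obtain ⟨n, rfl⟩ := Nat.exists_eq_add_of_le' hj
    exact Set.mem_iUnion.2 ⟨n, hj0⟩
  refine ENNReal.toReal_le_of_le_ofReal hB0 ?_
  refine (measure_mono hsub).trans ((measure_iUnion_le _).trans ?_)
  refine ENNReal.tsum_le_of_sum_range_le fun N => ?_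
  obtain ⟨M, hNM, hM⟩ := hB N
  refine (Finset.sum_le_sum_of_subset (Finset.range_mono hNM)).trans ?_
  simp_rw [← fun n => ofReal_measureReal (μ := P) (s := {ω | X (n + 1) ω = 0}) (measure_ne_top _ _)]
  rw [← ENNReal.ofReal_sum_of_nonneg fun _ _ => measureReal_nonneg]
  exact ENNReal.ofReal_le_ofReal hM

theorem mainTheorem7 {Ω : ℕ → Type*} [∀ d, MeasurableSpace (Ω d)]
    (P : (d : ℕ) → Measure (Ω d)) [∀ d, IsProbabilityMeasure (P d)]
    (X : (d : ℕ) → ℕ → Ω d → (Fin d → ℤ))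
    (hX : ∀ d, 1 ≤ d → IsSimpleRandomWalk (P d) d (X d)) :
    Tendsto (fun d : ℕ => 2 * (d : ℝ) * returnProb (P d) (X d)) atTop (𝓝 1) := by
  rw [tendsto_order]
  constructor
  · intro a ha
    filter_upwards [eventually_ge_atTop 1] with d hd
    have hd' : (0 : ℝ) < d := by exact_mod_cast hd
    have h := measureReal_le_returnProb (P := P d) (X := X d) 1
    rw [(hX d hd).measureReal_eq_zero, iterate_two_neighbourMean_originIndicator hd] at h
    refine ha.trans_le ?_
    calc (1 : ℝ) = 2 * d * (2 * (d : ℝ))⁻¹ := by field_simp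
      _ ≤ _ := mul_le_mul_of_nonneg_left h (by positivity)
  · intro a ha
    obtain ⟨ε, hε, hε', hεa⟩ : ∃ ε : ℝ, 0 < ε ∧ ε ≤ 1 / 2 ∧ 1 + 4 * ε ^ 2 < a := by
      -- With ε ≤ 1/2, 4ε² ≤ 2ε ≤ (a - 1)/2 < a - 1.
      have hm : 0 < min (1 / 2) ((a - 1) / 4) := lt_min (by norm_num) (by linarith)
      refine ⟨_, hm, min_le_left _ _, ?_⟩
      nlinarith [min_le_left (1 / 2) ((a - 1) / 4), min_le_right (1 / 2) ((a - 1) / 4)]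
    have h1 := tendsto_mul_integral_tiltedWeight_pow (s := 1) (by simp) hε hε'
    have h2 := tendsto_mul_integral_tiltedWeight_pow (s := -1) (by simp) hε hε'
    have hlim := ((h1.add h2).const_mul 4).const_add (1 + 4 * ε ^ 2)
    simp only [add_zero, mul_zero] at hlim
    filter_upwards [eventually_ge_atTop 1, eventually_two_div_le, hlim.eventually_lt_const hεa]
      with d hd hd2 hlt
    have hd' : (0 : ℝ) < d := by exact_mod_cast hd
    refine lt_of_le_of_lt ?_ hlt
    have h := returnProb_le_of_sum_le (P := P d) (X := X d) (B := (2 * (d : ℝ))⁻¹ +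
      2 * ∫ θ, tailMajorant d ε θ ∂unitCubeMeasure d) fun N => ⟨N + 3, by simp, by
        simp only [(hX d hd).measureReal_eq_zero, iterate_neighbourMean_originIndicator_zero]
        exact sum_integral_cosMean_pow_le hd hε hε' hd2 N⟩
    refine (mul_le_mul_of_nonneg_left h (by positivity)).trans_eq ?_
    rw [integral_tailMajorant hd hε.le hd2]
    field_simp
    ring
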